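/- There is an absolute constant $K$ such that the following holds. Let $k \ge 1$ and $d \ge 0$ be integers, let $Z_1,\dots,Z_k,\mu \in \mathbb{R}^d$ and $r > 0$, and suppose that $\mu$ is certifiably $(r,1/10)$-central with respect to $Z_1,\dots,Z_k$. Then for all reals $c, C > 0$ and $\gamma \in \mathbb{R}$, every degree-$8$ pseudoexpectation $\tilde{\mathbb{E}}$ satisfying the polynomial system $\mathcal{A}(Z_1,\dots,Z_k,r,C,c,\gamma)$ has $$\tilde{\mathbb{E}}\,\|x-\mu\|^2 \le K r^2 .$$ The notions used are the following. *Certifiable centrality.* A point $y\in\mathbb{R}^d$ is certifiably $(r,p)$-central with respect to $Z_1,\dots,Z_k$ if the semidefinite program $$\max\ \frac1k\sum_{i=1}^k b_i \quad\text{over}\quad \begin{pmatrix}1 & b^\top & u^\top\\ b & B & W\\ u & W^\top & U\end{pmatrix}\succeq 0,\quad b\in\mathbb{R}^k,\ u\in\mathbb{R}^d,\ B\in\mathbb{R}^{k\times k},\ W\in\mathbb{R}^{k\times d},\ U\in\mathbb{R}^{d\times d},$$ subject to $B_{ii}\le 1$ for all $i\le k$, $\operatorname{Tr}U\le 1$,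 and $\langle Z_i-y,W_i\rangle\ge r\,b_i$ for all $i \le k$ ($W_i$ being the $i$-th row of $W$), has value at most $p$. *The system.* Let $T$ be the largest integer with $T \le \log_2(C/c)+1$ (and $T=0$ if that integer is negative). The indeterminates of $\mathcal{A}(Z_1,\dots,Z_k,r,C,c,\gamma)$ are $\alpha_i,\beta_i$ ($1\le i\le k$), $\sigma_{ij}$ ($1\le i,j\le d+k+1$), $x_1,\dots,x_d$, and $a_{i,t}$ ($1\le i\le k$, $0\le t\le T$). Its constraints are: 1. the polynomial equations stating that the identity $$\frac{k}{10}-\sum_{i=1}^k b_i=\sum_{i=1}^k\alpha_i b_i(\langle Z_i-x,v\rangle-r)+\sum_{i=1}^k\beta_i(1-b_i^2)+\gamma(1-\|v\|^2)+\sum_{i=1}^{d+k+1}\langle\sigma_i,(1,b,v)\rangle^2$$ holds coefficient by coefficient in the variables $b_1,\dots,b_k,v_1,\dots,v_d$, where $\sigma_i=(\sigma_{ij})_j$; 2. $\alpha_i\ge 0$ and $\beta_i\ge 0$ for all $i$; 3. for all $i$: $a_{i,t}^2=a_{i,t}$ for $0 \le t\le T$; $a_{i,t}2^{t-1}c\le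 a_{i,t}\alpha_i\le a_{i,t}2^t c$ for $1\le t\le T$ (two inequalities); $a_{i,0}\alpha_i=0$; $\sum_{t=0}^T a_{i,t}=1$; and $a_{i,t}a_{i,t'}=0$ for $t\ne t'$. *Pseudoexpectations.* A degree-$n$ pseudoexpectation is a linear functional $\tilde{\mathbb{E}}$ on the real polynomials of degree at most $n$ in the indeterminates, with $\tilde{\mathbb{E}}\,1=1$ and $\tilde{\mathbb{E}}\,q^2\ge 0$ whenever $\deg q\le n/2$. It satisfies an equation $p=0$ if $\tilde{\mathbb{E}}\,pq=0$ for every polynomial $q$ with $\deg(pq)\le n$, and an inequality $p\ge 0$ if $\tilde{\mathbb{E}}\,pq^2\ge 0$ for every polynomial $q$ with $\deg(pq^2)\le n$; it satisfies a system if it satisfies every equation and inequality in it. -/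

import Mathlib

noncomputable section

/-! ### The centrality SDP and certifiable centrality -/

/-- Index set of the coordinates of `(1, b, v)` with `b ∈ ℝᵏ` and `v ∈ ℝᵈ`. -/
abbrev BlockIdx (k d : ℕ) : Type := Unit ⊕ (Fin k ⊕ Fin d)

/-- The position of the leading entry `1`. -/
abbrev BlockIdx.one {k d : ℕ} : BlockIdx k d := Sum.inl ()

/-- The position of `b_i`. -/
abbrev BlockIdx.b {k d : ℕ} (i : Fin k) : BlockIdx k d := Sum.inr (Sum.inl i)

/-- The position of the `j`-th coordinate of the direction. -/
abbrev BlockIdx.u {k d : ℕ} (j : Fin d) : BlockIdx k d := Sum.inr (Sum.inr j)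

/-- `Y` is a feasible solution of the centrality SDP with parameters `Z_1, …, Z_k, x, r`:
`Y` is a symmetric positive semidefinite block matrix
`((1, bᵀ, uᵀ), (b, B, W), (u, Wᵀ, U))` with `B_ii ≤ 1`, `Tr U ≤ 1` and
`⟨Z_i - x, W_i⟩ ≥ r b_i`, where `W_i` is the `i`-th row of `W`. -/
structure CentralityFeasible {k d : ℕ} (Z : Fin k → EuclideanSpace ℝ (Fin d))
    (x : EuclideanSpace ℝ (Fin d)) (r : ℝ)
    (Y : Matrix (BlockIdx k d) (BlockIdx k d) ℝ) : Prop where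
  posSemidef : Y.PosSemidef
  corner : Y BlockIdx.one BlockIdx.one = 1
  diag_le : ∀ i : Fin k, Y (BlockIdx.b i) (BlockIdx.b i) ≤ 1
  trace_le : ∑ j : Fin d, Y (BlockIdx.u j) (BlockIdx.u j) ≤ 1
  shift : ∀ i : Fin k,
    r * Y BlockIdx.one (BlockIdx.b i)
      ≤ ∑ j : Fin d, (Z i j - x j) * Y (BlockIdx.b i) (BlockIdx.u j)

/-- The objective `(1/k) ∑ b_i` of the centrality SDP. -/
def centralityObjective {k d : ℕ} (Y : Matrix (BlockIdx k d) (BlockIdx k d) ℝ) : ℝ :=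
  (1 / (k : ℝ)) * ∑ i : Fin k, Y BlockIdx.one (BlockIdx.b i)

/-- The set of objective values of feasible solutions of the centrality SDP. -/
def centralityValues {k d : ℕ} (Z : Fin k → EuclideanSpace ℝ (Fin d))
    (x : EuclideanSpace ℝ (Fin d)) (r : ℝ) : Set ℝ :=
  {s | ∃ Y : Matrix (BlockIdx k d) (BlockIdx k d) ℝ,
    CentralityFeasible Z x r Y ∧ s = centralityObjective Y}

/-- The value of the centrality SDP. The supremum is over a nonempty bounded set, see
`centralityValues_nonempty` and `centralityValues_bddAbove`. -/
def centralityValue {k d : ℕ} (Z : Fin k → EuclideanSpace ℝ (Fin d))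
    (x : EuclideanSpace ℝ (Fin d)) (r : ℝ) : ℝ :=
  sSup (centralityValues Z x r)

theorem centralityValues_nonempty {k d : ℕ} (Z : Fin k → EuclideanSpace ℝ (Fin d))
    (x : EuclideanSpace ℝ (Fin d)) (r : ℝ) : (centralityValues Z x r).Nonempty := by
  refine ⟨_, Matrix.diagonal (Sum.elim (fun _ => (1 : ℝ)) (fun _ => 0)), ?_, rfl⟩
  refine ⟨Matrix.PosSemidef.diagonal ?_, ?_, ?_, ?_, ?_⟩
  · rintro (_ | _) <;> simp
  all_goals simp [Matrix.diagonal]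

theorem centralityValues_bddAbove {k d : ℕ} (Z : Fin k → EuclideanSpace ℝ (Fin d))
    (x : EuclideanSpace ℝ (Fin d)) (r : ℝ) : BddAbove (centralityValues Z x r) := by
  refine ⟨(1 / (k : ℝ)) * ∑ _i : Fin k, (1 : ℝ), ?_⟩
  rintro s ⟨Y, hY, rfl⟩
  unfold centralityObjective
  refine mul_le_mul_of_nonneg_left (Finset.sum_le_sum fun i _ => ?_) (by positivity)
  have h := (hY.posSemidef.submatrix ![BlockIdx.one, BlockIdx.b i]).dotProduct_mulVec_nonneg
    ![1, -1]
  have hs : Y (BlockIdx.b i) BlockIdx.one = Y BlockIdx.one (BlockIdx.b i) := by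
    simpa using hY.posSemidef.isHermitian.apply BlockIdx.one (BlockIdx.b i)
  have h1 := hY.corner
  have h2 := hY.diag_le i
  simp [Matrix.mulVec, dotProduct, Fin.sum_univ_two] at h
  simp only [BlockIdx.one, BlockIdx.b] at *
  linarith

/-- `x` is certifiably `(r, p)`-central with respect to `Z_1, …, Z_k`: the value of the
centrality SDP is at most `p`. -/
def CertifiablyCentral {k d : ℕ} (Z : Fin k → EuclideanSpace ℝ (Fin d))
    (r p : ℝ) (x : EuclideanSpace ℝ (Fin d)) : Prop :=
  centralityValue Z x r ≤ p

/-! ### Pseudoexpectations -/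

/-- A degree-`n` pseudoexpectation in the variables `V`: a linear functional on the real
polynomials of (total) degree at most `n` which is normalized and nonnegative on squares of
polynomials of degree at most `n / 2`. -/
structure PseudoExpectation (V : Type) (n : ℕ) where
  toLinearMap : MvPolynomial.restrictTotalDegree V ℝ n →ₗ[ℝ] ℝ
  map_one : ∀ p : MvPolynomial.restrictTotalDegree V ℝ n,
    (p : MvPolynomial V ℝ) = 1 → toLinearMap p = 1
  map_sq_nonneg : ∀ (q : MvPolynomial V ℝ) (p : MvPolynomial.restrictTotalDegree V ℝ n),
    2 * q.totalDegree ≤ n → (p : MvPolynomial V ℝ) = q ^ 2 → 0 ≤ toLinearMap p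

/-- A system of polynomial equations `p = 0` (`p ∈ eqs`) and inequalities `p ≥ 0`
(`p ∈ ineqs`). -/
structure PolySystem (V : Type) where
  eqs : Set (MvPolynomial V ℝ)
  ineqs : Set (MvPolynomial V ℝ)

/-- The pseudoexpectation satisfies `p = 0`. -/
def PseudoExpectation.SatisfiesEq {V : Type} {n : ℕ} (E : PseudoExpectation V n)
    (p : MvPolynomial V ℝ) : Prop :=
  ∀ (q : MvPolynomial V ℝ) (h : p * q ∈ MvPolynomial.restrictTotalDegree V ℝ n),
    E.toLinearMap ⟨p * q, h⟩ = 0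

/-- The pseudoexpectation satisfies `p ≥ 0`. -/
def PseudoExpectation.SatisfiesIneq {V : Type} {n : ℕ} (E : PseudoExpectation V n)
    (p : MvPolynomial V ℝ) : Prop :=
  ∀ (q : MvPolynomial V ℝ) (h : p * q ^ 2 ∈ MvPolynomial.restrictTotalDegree V ℝ n),
    0 ≤ E.toLinearMap ⟨p * q ^ 2, h⟩

/-- The pseudoexpectation satisfies every equation and inequality of the system. -/
def PseudoExpectation.Satisfies {V : Type} {n : ℕ} (E : PseudoExpectation V n)
    (A : PolySystem V) : Prop :=
  (∀ p ∈ A.eqs, E.SatisfiesEq p) ∧ (∀ p ∈ A.ineqs, E.SatisfiesIneq p)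

/-! ### The polynomial system `𝒜(Z_1, …, Z_k, r, C, c, γ)` -/

/-- The number of levels `t ≥ 1`, i.e. the largest integer `t ≤ log₂ (C / c) + 1`
(and `0` if there is no such `t ≥ 1`). -/
def numLevels (C c : ℝ) : ℕ := ⌊Real.logb 2 (C / c) + 1⌋₊

/-- The indeterminates of the system: `α_i`, `β_i`, `σ_ij`, `x_j` and `a_{i,t}` with
`0 ≤ t ≤ T`. -/
inductive MedianVar (k d T : ℕ) : Type
  | alpha (i : Fin k)
  | beta (i : Fin k)
  | sigma (i j : BlockIdx k d)
  | x (j : Fin d)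
  | a (i : Fin k) (t : Fin (T + 1))

namespace MedianVar

variable {k d T : ℕ}

/-- The indeterminate `α_i` as a polynomial. -/
abbrev pAlpha (i : Fin k) : MvPolynomial (MedianVar k d T) ℝ := MvPolynomial.X (alpha i)

/-- The indeterminate `β_i` as a polynomial. -/
abbrev pBeta (i : Fin k) : MvPolynomial (MedianVar k d T) ℝ := MvPolynomial.X (beta i)

/-- The indeterminate `σ_ij` as a polynomial. -/
abbrev pSigma (i j : BlockIdx k d) : MvPolynomial (MedianVar k d T) ℝ :=
  MvPolynomial.X (sigma i j)

/-- The indeterminate `x_j` as a polynomial. -/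
abbrev pX (j : Fin d) : MvPolynomial (MedianVar k d T) ℝ := MvPolynomial.X (x j)

/-- The indeterminate `a_{i,t}` as a polynomial. -/
abbrev pA (i : Fin k) (t : Fin (T + 1)) : MvPolynomial (MedianVar k d T) ℝ :=
  MvPolynomial.X (a i t)

end MedianVar

open MedianVar in
/-- Left side minus right side of the certificate identity
`k/10 - ∑ b_i = ∑ α_i b_i (⟨Z_i - x, v⟩ - r) + ∑ β_i (1 - b_i²) + γ (1 - ‖v‖²)
  + ∑_i ⟨σ_i, (1, b, v)⟩²`,
as a polynomial in the variables `b_1, …, b_k, v_1, …, v_d` whose coefficients are polynomials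
in the indeterminates of the system. -/
def certificatePoly {k d : ℕ} (T : ℕ) (Z : Fin k → EuclideanSpace ℝ (Fin d)) (r γ : ℝ) :
    MvPolynomial (Fin k ⊕ Fin d) (MvPolynomial (MedianVar k d T) ℝ) :=
  let K : MvPolynomial (MedianVar k d T) ℝ →
      MvPolynomial (Fin k ⊕ Fin d) (MvPolynomial (MedianVar k d T) ℝ) := MvPolynomial.C
  let R : ℝ → MvPolynomial (Fin k ⊕ Fin d) (MvPolynomial (MedianVar k d T) ℝ) :=
    fun s => MvPolynomial.C (MvPolynomial.C s)
  let b : Fin k → MvPolynomial (Fin k ⊕ Fin d) (MvPolynomial (MedianVar k d T) ℝ) :=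
    fun i => MvPolynomial.X (Sum.inl i)
  let v : Fin d → MvPolynomial (Fin k ⊕ Fin d) (MvPolynomial (MedianVar k d T) ℝ) :=
    fun j => MvPolynomial.X (Sum.inr j)
  let w : BlockIdx k d → MvPolynomial (Fin k ⊕ Fin d) (MvPolynomial (MedianVar k d T) ℝ) :=
    Sum.elim (fun _ => 1) (Sum.elim b v)
  (R ((k : ℝ) / 10) - ∑ i, b i) -
    (∑ i, K (pAlpha i) * b i * (∑ j, (R (Z i j) - K (pX j)) * v j - R r)
      + ∑ i, K (pBeta i) * (1 - b i ^ 2)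
      + R γ * (1 - ∑ j, v j ^ 2)
      + ∑ i : BlockIdx k d, (∑ j : BlockIdx k d, K (pSigma i j) * w j) ^ 2)

open MedianVar in
/-- The polynomial system `𝒜(Z_1, …, Z_k, r, C, c, γ)`. -/
def medianSystem {k d : ℕ} (Z : Fin k → EuclideanSpace ℝ (Fin d)) (r C c γ : ℝ) :
    PolySystem (MedianVar k d (numLevels C c)) where
  eqs :=
    -- the certificate identity holds coefficientwise
    {p | ∃ m : (Fin k ⊕ Fin d) →₀ ℕ,
      p = MvPolynomial.coeff m (certificatePoly (numLevels C c) Z r γ)}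
    -- `a_{i,t}² = a_{i,t}`
    ∪ {p | ∃ (i : Fin k) (t : Fin (numLevels C c + 1)), p = pA i t ^ 2 - pA i t}
    -- `a_{i,0} α_i = 0`
    ∪ {p | ∃ i : Fin k, p = pA i 0 * pAlpha i}
    -- `∑_t a_{i,t} = 1`
    ∪ {p | ∃ i : Fin k, p = ∑ t : Fin (numLevels C c + 1), pA i t - 1}
    -- `a_{i,t} a_{i,t'} = 0` for `t ≠ t'`
    ∪ {p | ∃ (i : Fin k) (t t' : Fin (numLevels C c + 1)), t ≠ t' ∧ p = pA i t * pA i t'}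
  ineqs :=
    -- `α_i ≥ 0` and `β_i ≥ 0`
    {p | ∃ i : Fin k, p = pAlpha i}
    ∪ {p | ∃ i : Fin k, p = pBeta i}
    -- `a_{i,t} 2^(t-1) c ≤ a_{i,t} α_i` for `t = s + 1 ≥ 1`
    ∪ {p | ∃ (i : Fin k) (s : Fin (numLevels C c)),
        p = pA i s.succ * pAlpha i - pA i s.succ * MvPolynomial.C (2 ^ (s : ℕ) * c)}
    -- `a_{i,t} α_i ≤ a_{i,t} 2^t c` for `t = s + 1 ≥ 1`
    ∪ {p | ∃ (i : Fin k) (s : Fin (numLevels C c)),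
        p = pA i s.succ * MvPolynomial.C (2 ^ ((s : ℕ) + 1) * c) - pA i s.succ * pAlpha i}

/-- The polynomial `‖x - μ‖²` in the indeterminates `x_1, …, x_d`. -/
def sqDistPoly {k d T : ℕ} (μ : EuclideanSpace ℝ (Fin d)) :
    MvPolynomial (MedianVar k d T) ℝ :=
  ∑ j : Fin d, (MedianVar.pX j - MvPolynomial.C (μ j)) ^ 2

theorem sqDistPoly_mem {k d T : ℕ} (μ : EuclideanSpace ℝ (Fin d)) :
    (sqDistPoly μ : MvPolynomial (MedianVar k d T) ℝ) ∈
      MvPolynomial.restrictTotalDegree (MedianVar k d T) ℝ 8 := by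
  rw [MvPolynomial.mem_restrictTotalDegree]
  refine (MvPolynomial.totalDegree_finsetSum_le (d := 2) fun j _ => ?_).trans (by norm_num)
  refine (MvPolynomial.totalDegree_pow _ _).trans ?_
  have h := MvPolynomial.totalDegree_sub_C_le
    (MedianVar.pX j : MvPolynomial (MedianVar k d T) ℝ) (μ j)
  rw [MvPolynomial.totalDegree_X] at h
  omega

/-- The pseudo-expected squared distance `𝔼̃ ‖x - μ‖²`. -/
def PseudoExpectation.sqDist {k d T : ℕ} (E : PseudoExpectation (MedianVar k d T) 8)
    (μ : EuclideanSpace ℝ (Fin d)) : ℝ :=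
  E.toLinearMap ⟨sqDistPoly μ, sqDistPoly_mem μ⟩

end

/-! Suppose first that x is an actual point and that x and μ both carry dual certificates, with
multipliers α, β, γ and α', β', γ'. Put b_i = min(1, α'_i/α_i) and b'_i = min(1, α_i/α'_i), so that
α_i b_i = α'_i b'_i =: w_i. Test the certificate at x on (b, -s(x-μ)) and the one at μ on (b',
s(x-μ)). In the sum the points Z_i cancel, leaving s Σ w_i ‖x-μ‖² - 2r Σ w_i + (γ+γ')(1 - s²‖x-μ‖²)
≤ k/5 - Σ (b_i + b'_i). Since b_i + b'_i is bounded below by a constant exceeding 1/5, the choice s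
= 0 gives Σ w_i ≥ const·k/r, so the term linear in s is at least const·s·k‖x-μ‖²/r. Also γ, γ' ≤
k/10 and Σ w_i ≤ Σ α_i = O(k/r). A suitable s of order 1/r then forces ‖x-μ‖² = O(r²).

Three devices carry this over to degree-8 pseudoexpectations. Strong duality
(`CertifiablyCentral.exists_dual`) makes the multipliers at μ real numbers, and their Lagrangian
inequality applies to any pseudo-moment matrix (`CentralityDual.extend_le`). The certificate at x is
a polynomial identity, into which polynomials of degree one may be substituted (`certificate_le`).
The quotients α'_i/α_i are not polynomials, but the a_{i,t} behave as orthogonal idempotents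
recording the dyadic level of α_i. Rounding α_i to 2^t c turns b_i into the linear `levelPoly` and
b'_i into the quadratic `levelInvPoly`. The balance α_i b_i = α'_i b'_i stays exact, and rounding
costs only a weaker bound b_i + b'_i ≥ 1/2. -/

/-! ### Lagrangian duality for the centrality SDP -/

/-- A theorem of the alternative: a convex set that misses the open positive orthant has a
nonzero nonnegative functional that is nonpositive on it. -/
theorem exists_nonneg_multipliers {ι : Type*} [Fintype ι] {S : Set (ι → ℝ)} (hS : Convex ℝ S)
    (hne : S.Nonempty) (h : ∀ s ∈ S, ∃ i, s i ≤ 0) :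
    ∃ l : ι → ℝ, (∀ i, 0 ≤ l i) ∧ l ≠ 0 ∧ ∀ s ∈ S, ∑ i, s i * l i ≤ 0 := by
  classical
  let O : Set (ι → ℝ) := Set.univ.pi fun _ => Set.Ioi (0 : ℝ)
  have hO : IsOpen O := isOpen_set_pi Set.finite_univ fun _ _ => isOpen_Ioi
  have hOc : Convex ℝ O := convex_pi fun _ _ => convex_Ioi 0
  have hmem : ∀ x : ι → ℝ, x ∈ O ↔ ∀ i, 0 < x i := fun x => by simp [O]
  have hdis : Disjoint O S := by
    rw [Set.disjoint_left]
    intro x hx hxS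
    obtain ⟨i, hi⟩ := h x hxS
    exact absurd ((hmem x).1 hx i) (not_lt.2 hi)
  obtain ⟨f, u, hf, hu⟩ := geometric_hahn_banach_open hOc hO hS hdis
  have hscale : ∀ x ∈ O, ∀ t : ℝ, 0 < t → t * f x < u := by
    intro x hx t ht
    have := hf (t • x) ((hmem _).2 fun i => by
      simpa using mul_pos ht ((hmem x).1 hx i))
    simpa using this
  have h1 : (fun _ => 1 : ι → ℝ) ∈ O := (hmem _).2 fun _ => one_pos
  have hu0 : 0 ≤ u := by
    by_contra! hneg
    set y := f (fun _ => 1)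
    have hy := hscale _ h1 1 one_pos
    -- Since y < u < 0, this scaling is positive and moves the value to u/2, which is above u.
    have := hscale _ h1 (u / (2 * y)) (div_pos_of_neg_of_neg hneg (by linarith))
    have hy0 : y ≠ 0 := by intro h0; simp only [y] at h0; rw [h0] at hy; linarith
    have e : u / (2 * y) * y = u / 2 := by field_simp
    rw [e] at this
    linarith
  have hneg : ∀ x ∈ O, f x ≤ 0 := by
    intro x hx
    by_contra! hpos
    have := hscale x hx ((u + 1) / f x) (by positivity)
    rw [div_mul_cancel₀ _ hpos.ne'] at this
    linarith
  have hsum : ∀ x : ι → ℝ, f x = ∑ i, x i * f (fun j => if i = j then 1 else 0) := fun x => by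
    simpa using (f : (ι → ℝ) →ₗ[ℝ] ℝ).pi_apply_eq_sum_univ x
  refine ⟨fun i => -f (fun j => if i = j then 1 else 0), fun i => ?_, fun h0 => ?_, fun s hs => ?_⟩
  · by_contra! hc
    set e : ι → ℝ := fun j => if i = j then 1 else 0
    have he : 0 < f e := by linarith
    set y := f (fun _ => 1)
    -- The basis vector e lies only on the boundary of the orthant. Adding this multiple of the
    -- all-ones vector moves it inside and changes f by at most f e / 2.
    have hpos : 0 < f e / (2 * (|y| + 1)) := by positivity
    have := hneg (e + (f e / (2 * (|y| + 1))) • fun _ => 1) ((hmem _).2 fun j => by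
      have : 0 ≤ e j := by simp only [e]; split_ifs <;> simp
      simp only [Pi.add_apply, Pi.smul_apply, smul_eq_mul, mul_one]
      linarith)
    rw [map_add, map_smul, smul_eq_mul] at this
    change f e + f e / (2 * (|y| + 1)) * y ≤ 0 at this
    have hy : -(|y| + 1) ≤ y := by linarith [neg_abs_le y]
    have h2 : f e / (2 * (|y| + 1)) * -(|y| + 1) ≤ f e / (2 * (|y| + 1)) * y :=
      mul_le_mul_of_nonneg_left hy hpos.le
    have h3 : f e / (2 * (|y| + 1)) * -(|y| + 1) = -(f e / 2) := by
      field_simp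
    linarith
  · obtain ⟨s, hs⟩ := hne
    have hz : ∀ i, f (fun j => if i = j then 1 else 0) = 0 := fun i => by
      simpa using congrFun h0 i
    have hf0 : ∀ x, f x = 0 := fun x => by rw [hsum]; simp [hz]
    have ha := hf _ h1
    have hb := hu s hs
    rw [hf0] at ha hb
    linarith
  · have := hu s hs
    rw [hsum] at this
    simp only [mul_neg, Finset.sum_neg_distrib]
    linarith

/-- The slacks of the homogenized constraints of the centrality SDP at `Y`, together with the
excess of the objective over `1 / 10`. -/
noncomputable def centralitySlack {k d : ℕ} (Z : Fin k → EuclideanSpace ℝ (Fin d))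
    (x : EuclideanSpace ℝ (Fin d)) (r : ℝ) (Y : Matrix (BlockIdx k d) (BlockIdx k d) ℝ) :
    Unit ⊕ Unit ⊕ Fin k ⊕ Fin k → ℝ :=
  Sum.elim (fun _ => ∑ i : Fin k, Y BlockIdx.one (BlockIdx.b i)
      - (k : ℝ) / 10 * Y BlockIdx.one BlockIdx.one) <|
    Sum.elim (fun _ => Y BlockIdx.one BlockIdx.one
      - ∑ j : Fin d, Y (BlockIdx.u j) (BlockIdx.u j)) <|
    Sum.elim (fun i => Y BlockIdx.one BlockIdx.one - Y (BlockIdx.b i) (BlockIdx.b i))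
      fun i => ∑ j : Fin d, (Z i j - x j) * Y (BlockIdx.b i) (BlockIdx.u j)
        - r * Y BlockIdx.one (BlockIdx.b i)

theorem centralitySlack_add {k d : ℕ} (Z : Fin k → EuclideanSpace ℝ (Fin d))
    (x : EuclideanSpace ℝ (Fin d)) (r : ℝ) (Y Y' : Matrix (BlockIdx k d) (BlockIdx k d) ℝ) :
    centralitySlack Z x r (Y + Y') = centralitySlack Z x r Y + centralitySlack Z x r Y' := by
  funext i
  rcases i with _ | _ | i | i <;>
    simp [centralitySlack, mul_add, Finset.sum_add_distrib] <;> ring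

theorem centralitySlack_smul {k d : ℕ} (Z : Fin k → EuclideanSpace ℝ (Fin d))
    (x : EuclideanSpace ℝ (Fin d)) (r t : ℝ) (Y : Matrix (BlockIdx k d) (BlockIdx k d) ℝ) :
    centralitySlack Z x r (t • Y) = t • centralitySlack Z x r Y := by
  funext i
  rcases i with _ | _ | i | i <;>
    simp [centralitySlack, mul_sub, Finset.mul_sum, mul_left_comm]

/-- If all slacks were positive, the corner entry would exceed a diagonal entry (some i exists
because k > 0) and so be positive. Rescaling it to 1 would give a feasible point with objective
above 1/10. -/
theorem exists_centralitySlack_nonpos {k d : ℕ} (hk : 0 < k)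
    {Z : Fin k → EuclideanSpace ℝ (Fin d)} {x : EuclideanSpace ℝ (Fin d)} {r : ℝ}
    (hx : CertifiablyCentral Z r (1 / 10) x) {Y : Matrix (BlockIdx k d) (BlockIdx k d) ℝ}
    (hY : Y.PosSemidef) : ∃ i, centralitySlack Z x r Y i ≤ 0 := by
  by_contra! hpos
  set y := Y BlockIdx.one BlockIdx.one with hy
  have hy0 : 0 < y := by
    have h1 := hpos (Sum.inr (Sum.inr (Sum.inl ⟨0, hk⟩)))
    have h2 : 0 ≤ Y (BlockIdx.b ⟨0, hk⟩) (BlockIdx.b ⟨0, hk⟩) := hY.diag_nonneg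
    simp only [centralitySlack, Sum.elim_inr, Sum.elim_inl] at h1
    linarith
  have hsc : ∀ i, 0 < centralitySlack Z x r (y⁻¹ • Y) i := fun i => by
    rw [centralitySlack_smul]
    exact mul_pos (inv_pos.2 hy0) (hpos i)
  have hone : (y⁻¹ • Y) BlockIdx.one BlockIdx.one = 1 := by
    simp [← hy, hy0.ne']
  have hfeas : CentralityFeasible Z x r (y⁻¹ • Y) := by
    refine ⟨hY.smul (inv_nonneg.2 hy0.le), hone, fun i => ?_, ?_, fun i => ?_⟩
    · have := hsc (Sum.inr (Sum.inr (Sum.inl i)))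
      simp only [centralitySlack, Sum.elim_inr, Sum.elim_inl, hone] at this
      linarith
    · have := hsc (Sum.inr (Sum.inl ()))
      simp only [centralitySlack, Sum.elim_inr, Sum.elim_inl, hone] at this
      linarith
    · have := hsc (Sum.inr (Sum.inr (Sum.inr i)))
      simp only [centralitySlack, Sum.elim_inr] at this
      linarith
  have hle : centralityObjective (y⁻¹ • Y) ≤ 1 / 10 :=
    (le_csSup (centralityValues_bddAbove Z x r) ⟨_, hfeas, rfl⟩).trans hx
  have h0 := hsc (Sum.inl ())
  simp only [centralitySlack, Sum.elim_inl, hone] at h0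
  have hk' : (0 : ℝ) < k := Nat.cast_pos.2 hk
  rw [centralityObjective, one_div_mul_eq_div, div_le_iff₀ hk'] at hle
  linarith

/-- `α`, `β`, `γ` are Lagrange multipliers that certify the bound `1 / 10` on the value of the
centrality SDP, in homogeneous form. -/
structure CentralityDual {k d : ℕ} (Z : Fin k → EuclideanSpace ℝ (Fin d))
    (x : EuclideanSpace ℝ (Fin d)) (r : ℝ) (α β : Fin k → ℝ) (γ : ℝ) : Prop where
  alpha_nonneg : ∀ i, 0 ≤ α i
  beta_nonneg : ∀ i, 0 ≤ β i
  gamma_nonneg : 0 ≤ γ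
  lagrangian_le : ∀ Y : Matrix (BlockIdx k d) (BlockIdx k d) ℝ, Y.PosSemidef →
    ∑ i, α i * (∑ j, (Z i j - x j) * Y (BlockIdx.b i) (BlockIdx.u j)
        - r * Y BlockIdx.one (BlockIdx.b i))
      + ∑ i, β i * (Y BlockIdx.one BlockIdx.one - Y (BlockIdx.b i) (BlockIdx.b i))
      + γ * (Y BlockIdx.one BlockIdx.one - ∑ j, Y (BlockIdx.u j) (BlockIdx.u j))
    ≤ (k : ℝ) / 10 * Y BlockIdx.one BlockIdx.one
      - ∑ i : Fin k, Y BlockIdx.one (BlockIdx.b i)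

/-- Strong duality for the centrality SDP. -/
theorem CertifiablyCentral.exists_dual {k d : ℕ} (hk : 0 < k)
    {Z : Fin k → EuclideanSpace ℝ (Fin d)} {x : EuclideanSpace ℝ (Fin d)} {r : ℝ} (hr : 0 < r)
    (hx : CertifiablyCentral Z r (1 / 10) x) :
    ∃ (α β : Fin k → ℝ) (γ : ℝ), CentralityDual Z x r α β γ := by
  let S : Set (Unit ⊕ Unit ⊕ Fin k ⊕ Fin k → ℝ) :=
    centralitySlack Z x r '' {Y | Y.PosSemidef}
  have hconv : Convex ℝ S := by
    rintro _ ⟨Y, hY, rfl⟩ _ ⟨Y', hY', rfl⟩ a b ha hb -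
    exact ⟨a • Y + b • Y', Matrix.PosSemidef.add (Matrix.PosSemidef.smul hY ha)
      (Matrix.PosSemidef.smul hY' hb), by
        rw [centralitySlack_add, centralitySlack_smul, centralitySlack_smul]⟩
  obtain ⟨l, hl, hl0, hS⟩ := exists_nonneg_multipliers hconv
    ⟨_, 0, Matrix.PosSemidef.zero, rfl⟩ (by
      rintro _ ⟨Y, hY, rfl⟩
      exact exists_centralitySlack_nonpos hk hx hY)
  have hpos : 0 < l (Sum.inl ()) := by
    refine (hl _).lt_of_ne' fun h0 => hl0 ?_
    -- Slater point: at b = -1/2, u = 0 every constraint is strict (the shift slack is r/2), so a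
    -- vanishing multiplier of the objective would force all the others to vanish.
    let w : BlockIdx k d → ℝ := Sum.elim (fun _ => 1) (Sum.elim (fun _ => -1 / 2) fun _ => 0)
    have hw := hS _ ⟨_, Matrix.posSemidef_vecMulVec_self_star w, rfl⟩
    have hslack : ∀ i, 0 < centralitySlack Z x r (Matrix.vecMulVec w (star w)) (Sum.inr i) := by
      rintro (_ | i | i) <;> simp [centralitySlack, Matrix.vecMulVec, w] <;> linarith
    rw [Fintype.sum_sum_type] at hw
    simp only [Finset.univ_unique, Finset.sum_singleton] at hw
    have hu : l (Sum.inl default) = 0 := h0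
    rw [hu, mul_zero, zero_add] at hw
    have hz := (Finset.sum_eq_zero_iff_of_nonneg fun i _ =>
      mul_nonneg (hslack i).le (hl (Sum.inr i))).1
        (le_antisymm hw (Finset.sum_nonneg fun i _ => mul_nonneg (hslack i).le (hl _)))
    funext i
    rcases i with _ | i
    · exact h0
    · exact (mul_eq_zero.1 (hz i (Finset.mem_univ i))).resolve_left (hslack i).ne'
  set l0 := l (Sum.inl ()) with hl0'
  refine ⟨fun i => l (Sum.inr (Sum.inr (Sum.inr i))) / l0,
    fun i => l (Sum.inr (Sum.inr (Sum.inl i))) / l0, l (Sum.inr (Sum.inl ())) / l0,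
    fun i => div_nonneg (hl _) hpos.le, fun i => div_nonneg (hl _) hpos.le,
    div_nonneg (hl _) hpos.le, fun Y hY => ?_⟩
  have h := hS _ ⟨Y, hY, rfl⟩
  simp only [Fintype.sum_sum_type, Finset.univ_unique, Finset.sum_singleton, centralitySlack,
    Sum.elim_inl, Sum.elim_inr, PUnit.default_eq_unit, ← hl0'] at h
  simp only [div_mul_eq_mul_div, ← Finset.sum_div]
  rw [← add_div, ← add_div, div_le_iff₀ hpos]
  simp only [mul_comm (l _)]
  linarith

/-! ### Degree bounds -/

namespace MvPolynomial

theorem totalDegree_mul_le_of_le {σ R : Type*} [CommSemiring R] {p q : MvPolynomial σ R} {m n : ℕ}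
    (hp : p.totalDegree ≤ m) (hq : q.totalDegree ≤ n) : (p * q).totalDegree ≤ m + n :=
  (totalDegree_mul p q).trans (add_le_add hp hq)

theorem totalDegree_pow_le_of_le {σ R : Type*} [CommSemiring R] {p : MvPolynomial σ R} {m : ℕ}
    (hp : p.totalDegree ≤ m) (n : ℕ) : (p ^ n).totalDegree ≤ n * m :=
  (totalDegree_pow p n).trans (Nat.mul_le_mul_left n hp)

theorem totalDegree_sub_le_of_le {σ R : Type*} [CommRing R] {p q : MvPolynomial σ R} {n : ℕ}
    (hp : p.totalDegree ≤ n) (hq : q.totalDegree ≤ n) : (p - q).totalDegree ≤ n :=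
  (totalDegree_sub p q).trans (max_le hp hq)

theorem totalDegree_add_le_of_le {σ R : Type*} [CommSemiring R] {p q : MvPolynomial σ R} {n : ℕ}
    (hp : p.totalDegree ≤ n) (hq : q.totalDegree ≤ n) : (p + q).totalDegree ≤ n :=
  (totalDegree_add p q).trans (max_le hp hq)

theorem totalDegree_C_mul_le_of_le {σ R : Type*} [CommSemiring R] {p : MvPolynomial σ R} {n : ℕ}
    (a : R) (hp : p.totalDegree ≤ n) : (C a * p).totalDegree ≤ n := by
  simpa using totalDegree_mul_le_of_le (totalDegree_C (σ := σ) a).le hp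

theorem totalDegree_C_le {σ R : Type*} [CommSemiring R] (a : R) (n : ℕ) :
    (C a : MvPolynomial σ R).totalDegree ≤ n :=
  (totalDegree_C a).le.trans n.zero_le

theorem totalDegree_X_le {σ R : Type*} [CommSemiring R] [Nontrivial R] (i : σ) :
    (X i : MvPolynomial σ R).totalDegree ≤ 1 :=
  (totalDegree_X i).le

theorem totalDegree_one_le {σ R : Type*} [CommSemiring R] (n : ℕ) :
    (1 : MvPolynomial σ R).totalDegree ≤ n :=
  totalDegree_one.le.trans n.zero_le

theorem totalDegree_zero_le {σ R : Type*} [CommSemiring R] (n : ℕ) :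
    (0 : MvPolynomial σ R).totalDegree ≤ n :=
  totalDegree_zero.le.trans n.zero_le

/-- The coefficients of `p`, themselves polynomials, have total degree at most `n`. -/
def CoeffDegreeLE {τ σ R : Type*} [CommSemiring R] (n : ℕ)
    (p : MvPolynomial τ (MvPolynomial σ R)) : Prop :=
  ∀ m, (p.coeff m).totalDegree ≤ n

namespace CoeffDegreeLE

variable {τ σ R : Type*} [CommRing R] {m n : ℕ} {p q : MvPolynomial τ (MvPolynomial σ R)}

theorem mono (hp : CoeffDegreeLE m p) (h : m ≤ n) : CoeffDegreeLE n p :=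
  fun i => (hp i).trans h

theorem add (hp : CoeffDegreeLE n p) (hq : CoeffDegreeLE n q) : CoeffDegreeLE n (p + q) :=
  fun i => by rw [coeff_add]; exact totalDegree_add_le_of_le (hp i) (hq i)

theorem sub (hp : CoeffDegreeLE n p) (hq : CoeffDegreeLE n q) : CoeffDegreeLE n (p - q) :=
  fun i => by rw [coeff_sub]; exact totalDegree_sub_le_of_le (hp i) (hq i)

theorem sum {ι : Type*} {s : Finset ι} {f : ι → MvPolynomial τ (MvPolynomial σ R)}
    (h : ∀ i ∈ s, CoeffDegreeLE n (f i)) : CoeffDegreeLE n (∑ i ∈ s, f i) :=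
  fun i => by rw [coeff_sum]; exact totalDegree_finsetSum_le fun j hj => h j hj i

theorem mul (hp : CoeffDegreeLE m p) (hq : CoeffDegreeLE n q) : CoeffDegreeLE (m + n) (p * q) :=
  fun i => by
    classical
    rw [coeff_mul]
    exact totalDegree_finsetSum_le fun j _ => totalDegree_mul_le_of_le (hp _) (hq _)

theorem C {a : MvPolynomial σ R} (ha : a.totalDegree ≤ n) :
    CoeffDegreeLE n (C a : MvPolynomial τ (MvPolynomial σ R)) := fun i => by
  classical
  rw [coeff_C]
  split_ifs
  exacts [ha, totalDegree_zero_le n]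

theorem one : CoeffDegreeLE 0 (1 : MvPolynomial τ (MvPolynomial σ R)) :=
  CoeffDegreeLE.C totalDegree_one.le

theorem X (i : τ) : CoeffDegreeLE 0 (X i : MvPolynomial τ (MvPolynomial σ R)) := fun m => by
  classical
  rw [coeff_X]
  split_ifs <;> simp

end CoeffDegreeLE

end MvPolynomial

/-! ### Pseudoexpectations as functionals on all polynomials -/

namespace PseudoExpectation

variable {V : Type} {n : ℕ} (E : PseudoExpectation V n)

/-- A linear extension of a pseudoexpectation to all polynomials. -/
noncomputable def extend : MvPolynomial V ℝ →ₗ[ℝ] ℝ :=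
  (LinearMap.exists_extend E.toLinearMap).choose

theorem extend_eq {p : MvPolynomial V ℝ} (hp : p ∈ MvPolynomial.restrictTotalDegree V ℝ n) :
    E.extend p = E.toLinearMap ⟨p, hp⟩ :=
  LinearMap.congr_fun (LinearMap.exists_extend E.toLinearMap).choose_spec ⟨p, hp⟩

theorem extend_one : E.extend 1 = 1 := by
  have h : (1 : MvPolynomial V ℝ) ∈ MvPolynomial.restrictTotalDegree V ℝ n := by
    simp [MvPolynomial.mem_restrictTotalDegree]
  rw [E.extend_eq h, E.map_one _ rfl]

theorem extend_C_mul (a : ℝ) (p : MvPolynomial V ℝ) :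
    E.extend (MvPolynomial.C a * p) = a * E.extend p := by
  rw [← MvPolynomial.smul_eq_C_mul, map_smul, smul_eq_mul]

theorem extend_sq_nonneg {q : MvPolynomial V ℝ} (hq : 2 * q.totalDegree ≤ n) :
    0 ≤ E.extend (q ^ 2) := by
  have h : q ^ 2 ∈ MvPolynomial.restrictTotalDegree V ℝ n := by
    rw [MvPolynomial.mem_restrictTotalDegree]
    exact (MvPolynomial.totalDegree_pow _ _).trans hq
  rw [E.extend_eq h]
  exact E.map_sq_nonneg q _ hq rfl

variable {E}

theorem SatisfiesEq.extend_mul_eq_zero {p q : MvPolynomial V ℝ} (h : E.SatisfiesEq p)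
    (hq : (p * q).totalDegree ≤ n) : E.extend (p * q) = 0 := by
  have hm := (MvPolynomial.mem_restrictTotalDegree V n (p * q)).2 hq
  rw [E.extend_eq hm]
  exact h q hm

theorem SatisfiesIneq.extend_mul_sq_nonneg {p q : MvPolynomial V ℝ} (h : E.SatisfiesIneq p)
    (hq : (p * q ^ 2).totalDegree ≤ n) : 0 ≤ E.extend (p * q ^ 2) := by
  have hm := (MvPolynomial.mem_restrictTotalDegree V n (p * q ^ 2)).2 hq
  rw [E.extend_eq hm]
  exact h q hm

end PseudoExpectation

/-! ### Substituting polynomials into the certificate identity -/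

open MedianVar MvPolynomial

section Certificate

variable {k d T : ℕ} (Z : Fin k → EuclideanSpace ℝ (Fin d)) (r γ : ℝ)

theorem certificatePoly_coeffDegreeLE : CoeffDegreeLE 2 (certificatePoly T Z r γ) := by
  have hw : ∀ j : BlockIdx k d, CoeffDegreeLE 0 (Sum.elim (fun _ => 1)
      (Sum.elim (fun i => X (Sum.inl i)) fun j => X (Sum.inr j)) j :
        MvPolynomial (Fin k ⊕ Fin d) (MvPolynomial (MedianVar k d T) ℝ)) := by
    rintro (_ | _ | _)
    exacts [CoeffDegreeLE.one, CoeffDegreeLE.X _, CoeffDegreeLE.X _]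
  have hC : ∀ (s : ℝ) (n : ℕ), CoeffDegreeLE n (C (C s) :
      MvPolynomial (Fin k ⊕ Fin d) (MvPolynomial (MedianVar k d T) ℝ)) :=
    fun s n => CoeffDegreeLE.C (totalDegree_C_le s n)
  have hX : ∀ y : MedianVar k d T, CoeffDegreeLE 1 (C (X y) :
      MvPolynomial (Fin k ⊕ Fin d) (MvPolynomial (MedianVar k d T) ℝ)) :=
    fun y => CoeffDegreeLE.C (totalDegree_X_le y)
  have hb := fun i => CoeffDegreeLE.X (R := ℝ) (σ := MedianVar k d T) (τ := Fin k ⊕ Fin d) i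
  unfold certificatePoly
  simp only [pow_two]
  refine .sub (.sub (hC _ _) (.sum fun i _ => (hb _).mono zero_le)) (.add (.add (.add ?_ ?_) ?_) ?_)
  · exact .sum fun i _ => .mul ((hX _).mul (hb _)) (.sub (.sum fun j _ =>
      .mul (m := 1) (n := 0) (.sub (hC _ _) (hX _)) (hb _)) (hC _ _))
  · exact .sum fun i _ => .mono (.mul (hX _) (.sub CoeffDegreeLE.one ((hb _).mul (hb _))))
      (by norm_num)
  · exact .mono (.mul (hC _ 0) (.sub CoeffDegreeLE.one (.sum fun j _ => (hb _).mul (hb _))))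
      (by norm_num)
  · exact .sum fun i _ => .mul (m := 1) (n := 1) (.sum fun j _ => (hX _).mul (hw _))
      (.sum fun j _ => (hX _).mul (hw _))

theorem certificatePoly_totalDegree_le : (certificatePoly T Z r γ).totalDegree ≤ 2 := by
  have hw : ∀ j : BlockIdx k d, (Sum.elim (fun _ => 1)
      (Sum.elim (fun i => X (Sum.inl i)) fun j => X (Sum.inr j)) j :
        MvPolynomial (Fin k ⊕ Fin d) (MvPolynomial (MedianVar k d T) ℝ)).totalDegree ≤ 1 := by
    rintro (_ | _ | _)
    exacts [totalDegree_one_le _, totalDegree_X_le _, totalDegree_X_le _]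
  have hC := fun p n => totalDegree_C_le (R := MvPolynomial (MedianVar k d T) ℝ)
    (σ := Fin k ⊕ Fin d) p n
  have hb := fun i => totalDegree_X_le (R := MvPolynomial (MedianVar k d T) ℝ)
    (σ := Fin k ⊕ Fin d) i
  unfold certificatePoly
  refine totalDegree_sub_le_of_le (totalDegree_sub_le_of_le (hC _ _)
    (totalDegree_finsetSum_le fun i _ => (hb _).trans one_le_two)) (totalDegree_add_le_of_le
      (totalDegree_add_le_of_le (totalDegree_add_le_of_le ?_ ?_) ?_) ?_)
  · refine totalDegree_finsetSum_le fun i _ => ?_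
    rw [mul_assoc]
    exact totalDegree_C_mul_le_of_le _ (totalDegree_mul_le_of_le (m := 1) (n := 1) (hb _)
      (totalDegree_sub_le_of_le (totalDegree_finsetSum_le fun j _ =>
        totalDegree_mul_le_of_le (m := 0) (n := 1)
          (totalDegree_sub_le_of_le (hC _ _) (hC _ _)) (hb _)) (hC _ _)))
  · exact totalDegree_finsetSum_le fun i _ => totalDegree_C_mul_le_of_le _
      (totalDegree_sub_le_of_le (totalDegree_one_le _) (totalDegree_pow_le_of_le (hb _) 2))
  · exact totalDegree_C_mul_le_of_le _ (totalDegree_sub_le_of_le (totalDegree_one_le _)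
      (totalDegree_finsetSum_le fun j _ => totalDegree_pow_le_of_le (hb _) 2))
  · exact totalDegree_finsetSum_le fun i _ => totalDegree_pow_le_of_le (m := 1)
      (totalDegree_finsetSum_le fun j _ => totalDegree_C_mul_le_of_le _ (hw j)) 2

end Certificate

section System

variable {k d : ℕ} {Z : Fin k → EuclideanSpace ℝ (Fin d)} {r C' c γ : ℝ}
  {E : PseudoExpectation (MedianVar k d (numLevels C' c)) 8}

/-- Each coefficient is an equation of the system of degree at most 2, and it multiplies a
substituted monomial of degree at most 2. Together with Q this fits the budget 2 + 2 + 4 = 8. -/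
theorem PseudoExpectation.Satisfies.extend_mul_eval_certificatePoly
    (hE : E.Satisfies (medianSystem Z r C' c γ))
    {w : Fin k ⊕ Fin d → MvPolynomial (MedianVar k d (numLevels C' c)) ℝ}
    (hw : ∀ i, (w i).totalDegree ≤ 1) {Q : MvPolynomial (MedianVar k d (numLevels C' c)) ℝ}
    (hQ : Q.totalDegree ≤ 4) :
    E.extend (Q * eval w (certificatePoly (numLevels C' c) Z r γ)) = 0 := by
  rw [eval_eq', Finset.mul_sum, map_sum]
  refine Finset.sum_eq_zero fun m hm => ?_
  have hdeg : ∑ i, m i ≤ 2 := by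
    refine le_trans ?_ (certificatePoly_totalDegree_le (T := numLevels C' c) Z r γ)
    refine le_trans (le_of_eq ?_) (le_totalDegree hm)
    rw [Finsupp.sum_fintype _ _ fun _ => rfl]
  have hprod : (∏ i, w i ^ m i).totalDegree ≤ 2 := by
    refine (totalDegree_finsetProd _ _).trans (le_trans (Finset.sum_le_sum fun i _ => ?_) hdeg)
    simpa using totalDegree_pow_le_of_le (hw i) (m i)
  rw [mul_left_comm]
  refine (hE.1 _ ?_).extend_mul_eq_zero (totalDegree_mul_le_of_le
    (certificatePoly_coeffDegreeLE Z r γ m) (totalDegree_mul_le_of_le hQ hprod))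
  exact Or.inl (Or.inl (Or.inl (Or.inl ⟨m, rfl⟩)))

/-- The certificate identity, with polynomials `b_i` and `v_j` substituted for its variables and
multiplied by a square `q²`. -/
theorem PseudoExpectation.Satisfies.certificate_le
    (hE : E.Satisfies (medianSystem Z r C' c γ))
    {b : Fin k → MvPolynomial (MedianVar k d (numLevels C' c)) ℝ}
    {v : Fin d → MvPolynomial (MedianVar k d (numLevels C' c)) ℝ}
    (hb : ∀ i, (b i).totalDegree ≤ 1) (hv : ∀ j, (v j).totalDegree ≤ 1)
    {q : MvPolynomial (MedianVar k d (numLevels C' c)) ℝ} (hq : q.totalDegree ≤ 1) :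
    ∑ i, E.extend (q ^ 2 * (pAlpha i * b i * (∑ j, (C (Z i j) - pX j) * v j - C r)))
        + ∑ i, E.extend (q ^ 2 * (pBeta i * (1 - b i ^ 2)))
        + γ * E.extend (q ^ 2 * (1 - ∑ j, v j ^ 2))
      ≤ (k : ℝ) / 10 * E.extend (q ^ 2) - ∑ i, E.extend (q ^ 2 * b i) := by
  have hw : ∀ i, (Sum.elim b v i).totalDegree ≤ 1 := by
    rintro (i | j)
    exacts [hb i, hv j]
  have h := hE.extend_mul_eval_certificatePoly hw
    ((totalDegree_pow_le_of_le hq 2).trans (by norm_num : 2 * 1 ≤ 4))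
  let w' : BlockIdx k d → MvPolynomial (MedianVar k d (numLevels C' c)) ℝ :=
    Sum.elim (fun _ => 1) (Sum.elim b v)
  have hw' : ∀ j, (w' j).totalDegree ≤ 1 := by
    rintro (_ | i | j)
    exacts [totalDegree_one_le 1, hb i, hv j]
  -- The sum-of-squares part, multiplied by q², is a sum of squares of polynomials of degree at most
  -- 3, so it can be dropped.
  have hsq : ∀ i, 0 ≤ E.extend ((q * ∑ j, pSigma i j * w' j) ^ 2) := fun i =>
    E.extend_sq_nonneg (Nat.mul_le_mul_left 2 (totalDegree_mul_le_of_le (n := 2) hq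
      (totalDegree_finsetSum_le fun j _ =>
        totalDegree_mul_le_of_le (totalDegree_X_le _) (hw' j))) |>.trans (by norm_num))
  have hsum := Finset.sum_nonneg fun i (_ : i ∈ Finset.univ) => hsq i
  have e : eval (Sum.elim b v) (certificatePoly (numLevels C' c) Z r γ) =
      (C ((k : ℝ) / 10) - ∑ i, b i) -
        (∑ i, pAlpha i * b i * (∑ j, (C (Z i j) - pX j) * v j - C r)
          + ∑ i, pBeta i * (1 - b i ^ 2) + C γ * (1 - ∑ j, v j ^ 2)
          + ∑ i, (∑ j, pSigma i j * w' j) ^ 2) := by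
    simp [certificatePoly, w', Fintype.sum_sum_type]
  have e2 : q ^ 2 * eval (Sum.elim b v) (certificatePoly (numLevels C' c) Z r γ) =
      C ((k : ℝ) / 10) * q ^ 2 - ∑ i, q ^ 2 * b i -
        (∑ i, q ^ 2 * (pAlpha i * b i * (∑ j, (C (Z i j) - pX j) * v j - C r))
          + ∑ i, q ^ 2 * (pBeta i * (1 - b i ^ 2)) + C γ * (q ^ 2 * (1 - ∑ j, v j ^ 2))
          + ∑ i, (q * ∑ j, pSigma i j * w' j) ^ 2) := by
    rw [e]
    simp only [mul_pow, ← Finset.mul_sum]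
    ring
  rw [e2] at h
  simp only [map_sub, map_add, map_sum, E.extend_C_mul] at h
  linarith

end System

/-! ### Dyadic levels -/

section Levels

/-- The weight `min (1, s / (2^t c))` of level `t`, with `1` at level `0`. -/
noncomputable def levelWeight (c s : ℝ) {T : ℕ} : Fin (T + 1) → ℝ :=
  Fin.cases 1 fun t => s / max (2 ^ ((t : ℕ) + 1) * c) s

/-- The weight `1 / max (2^t c, s)` of level `t`, with `0` at level `0`. -/
noncomputable def levelInvWeight (c s : ℝ) {T : ℕ} : Fin (T + 1) → ℝ :=
  Fin.cases 0 fun t => 1 / max (2 ^ ((t : ℕ) + 1) * c) s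

theorem levelWeight_nonneg {c s : ℝ} (hc : 0 < c) (hs : 0 ≤ s) {T : ℕ} (t : Fin (T + 1)) :
    0 ≤ levelWeight c s t := by
  refine Fin.cases ?_ (fun t => ?_) t
  · simp [levelWeight]
  · simp only [levelWeight, Fin.cases_succ]
    positivity

theorem levelWeight_le_one {c s : ℝ} (hc : 0 < c) {T : ℕ} (t : Fin (T + 1)) :
    levelWeight c s t ≤ 1 := by
  refine Fin.cases ?_ (fun t => ?_) t
  · simp [levelWeight]
  · simp only [levelWeight, Fin.cases_succ]
    exact div_le_one_of_le₀ (le_max_right _ _) (by positivity)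

theorem levelInvWeight_nonneg {c s : ℝ} (hc : 0 < c) {T : ℕ} (t : Fin (T + 1)) :
    0 ≤ levelInvWeight c s t := by
  refine Fin.cases ?_ (fun t => ?_) t
  · simp [levelInvWeight]
  · simp only [levelInvWeight, Fin.cases_succ]
    positivity

variable {k d : ℕ} {C' c : ℝ}

/-- The polynomial `∑_t m_t a_{i,t}` with the weights `levelWeight c s`. -/
noncomputable def levelPoly (c s : ℝ) (i : Fin k) :
    MvPolynomial (MedianVar k d (numLevels C' c)) ℝ :=
  ∑ t, C (levelWeight c s t) * pA i t

/-- The polynomial `α_i ∑_t n_t a_{i,t}` with the weights `levelInvWeight c s`. -/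
noncomputable def levelInvPoly (c s : ℝ) (i : Fin k) :
    MvPolynomial (MedianVar k d (numLevels C' c)) ℝ :=
  pAlpha i * ∑ t, C (levelInvWeight c s t) * pA i t

theorem totalDegree_levelSum_le (m : Fin (numLevels C' c + 1) → ℝ) (i : Fin k) :
    (∑ t, C (m t) * pA i t :
      MvPolynomial (MedianVar k d (numLevels C' c)) ℝ).totalDegree ≤ 1 :=
  totalDegree_finsetSum_le fun _ _ => totalDegree_C_mul_le_of_le _ (totalDegree_X_le _)

theorem totalDegree_levelInvPoly_le (s : ℝ) (i : Fin k) :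
    (levelInvPoly c s i :
      MvPolynomial (MedianVar k d (numLevels C' c)) ℝ).totalDegree ≤ 2 :=
  totalDegree_mul_le_of_le (totalDegree_X_le _) (totalDegree_levelSum_le _ i)

variable {Z : Fin k → EuclideanSpace ℝ (Fin d)} {r γ : ℝ}
  {E : PseudoExpectation (MedianVar k d (numLevels C' c)) 8}
  {p q : MvPolynomial (MedianVar k d (numLevels C' c)) ℝ}

namespace PseudoExpectation

/-! ### Calculus of the level indicators under the pseudoexpectation. -/

variable (E) in
theorem extend_mul_levelSum (m : Fin (numLevels C' c + 1) → ℝ) (i : Fin k)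
    (p : MvPolynomial (MedianVar k d (numLevels C' c)) ℝ) :
    E.extend (p * ∑ t, C (m t) * pA i t) = ∑ t, m t * E.extend (p * pA i t) := by
  rw [Finset.mul_sum, map_sum]
  refine Finset.sum_congr rfl fun t _ => ?_
  rw [mul_left_comm, E.extend_C_mul]

namespace Satisfies

theorem sum_extend_mul_level (hE : E.Satisfies (medianSystem Z r C' c γ)) (i : Fin k)
    (hp : p.totalDegree ≤ 7) : ∑ t, E.extend (p * pA i t) = E.extend p := by
  have h := (hE.1 (∑ t, pA i t - 1) (Or.inl (Or.inr ⟨i, rfl⟩))).extend_mul_eq_zero (q := p)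
    (totalDegree_mul_le_of_le (m := 1) (totalDegree_sub_le_of_le
      (totalDegree_finsetSum_le fun _ _ => totalDegree_X_le _) (totalDegree_one_le _)) hp)
  rw [sub_mul, one_mul, map_sub, mul_comm, Finset.mul_sum, map_sum] at h
  linarith

theorem extend_mul_level_sq (hE : E.Satisfies (medianSystem Z r C' c γ)) (i : Fin k)
    (t : Fin (numLevels C' c + 1)) (hp : p.totalDegree ≤ 6) :
    E.extend (p * pA i t ^ 2) = E.extend (p * pA i t) := by
  have h := (hE.1 (pA i t ^ 2 - pA i t)
    (Or.inl (Or.inl (Or.inl (Or.inr ⟨i, t, rfl⟩))))).extend_mul_eq_zero (q := p)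
    (totalDegree_mul_le_of_le (m := 2) (totalDegree_sub_le_of_le
      (totalDegree_pow_le_of_le (totalDegree_X_le _) 2)
      ((totalDegree_X_le _).trans one_le_two)) hp)
  rw [sub_mul, map_sub, mul_comm, mul_comm _ p] at h
  linarith

theorem extend_mul_alpha_level_zero (hE : E.Satisfies (medianSystem Z r C' c γ)) (i : Fin k)
    (hp : p.totalDegree ≤ 6) : E.extend (p * pAlpha i * pA i 0) = 0 := by
  have h := (hE.1 (pA i 0 * pAlpha i)
    (Or.inl (Or.inl (Or.inr ⟨i, rfl⟩)))).extend_mul_eq_zero (q := p)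
    (totalDegree_mul_le_of_le (m := 2)
      (totalDegree_mul_le_of_le (totalDegree_X_le _) (totalDegree_X_le _)) hp)
  rw [← h]
  ring_nf

theorem extend_mul_level_mul_level (hE : E.Satisfies (medianSystem Z r C' c γ)) (i : Fin k)
    {t t' : Fin (numLevels C' c + 1)} (htt : t ≠ t') (hp : p.totalDegree ≤ 6) :
    E.extend (p * (pA i t * pA i t')) = 0 := by
  rw [mul_comm]
  exact (hE.1 (pA i t * pA i t') (Or.inr ⟨i, t, t', htt, rfl⟩)).extend_mul_eq_zero
    (totalDegree_mul_le_of_le (m := 2)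
      (totalDegree_mul_le_of_le (totalDegree_X_le _) (totalDegree_X_le _)) hp)

/-- Orthogonality kills the cross terms and idempotence reduces the squares, so squaring acts on the
weights level by level. -/
theorem extend_mul_levelSum_sq (hE : E.Satisfies (medianSystem Z r C' c γ)) (i : Fin k)
    (m : Fin (numLevels C' c + 1) → ℝ) (hp : p.totalDegree ≤ 6) :
    E.extend (p * (∑ t, C (m t) * pA i t) ^ 2) = ∑ t, m t ^ 2 * E.extend (p * pA i t) := by
  rw [pow_two, Finset.sum_mul_sum, Finset.mul_sum, map_sum]
  refine Finset.sum_congr rfl fun t _ => ?_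
  rw [Finset.mul_sum, map_sum, Finset.sum_eq_single t]
  · rw [← hE.extend_mul_level_sq i t hp, ← E.extend_C_mul, C_pow]
    ring_nf
  · intro t' _ ht'
    have e : p * (C (m t) * pA i t * (C (m t') * pA i t')) =
        C (m t * m t') * (p * (pA i t * pA i t')) := by
      rw [C_mul]; ring
    rw [e, E.extend_C_mul, hE.extend_mul_level_mul_level i ht'.symm hp, mul_zero]
  · simp

theorem extend_sq_mul_level_nonneg (hE : E.Satisfies (medianSystem Z r C' c γ)) (i : Fin k)
    (t : Fin (numLevels C' c + 1)) (hq : q.totalDegree ≤ 3) :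
    0 ≤ E.extend (q ^ 2 * pA i t) := by
  rw [← hE.extend_mul_level_sq i t (totalDegree_pow_le_of_le hq 2), ← mul_pow]
  exact E.extend_sq_nonneg (Nat.mul_le_mul_left 2
    (totalDegree_mul_le_of_le hq (totalDegree_X_le _)))

/-- An inequality of degree one stays valid after multiplication by a level indicator. -/
theorem extend_sq_mul_ineq_level_nonneg (hE : E.Satisfies (medianSystem Z r C' c γ)) (i : Fin k)
    (t : Fin (numLevels C' c + 1)) (hp : E.SatisfiesIneq p) (hpd : p.totalDegree ≤ 1)
    (hq : q.totalDegree ≤ 2) : 0 ≤ E.extend (q ^ 2 * p * pA i t) := by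
  rw [← hE.extend_mul_level_sq i t ((totalDegree_mul_le_of_le
    (totalDegree_pow_le_of_le hq 2) hpd).trans (by norm_num))]
  have h := hp.extend_mul_sq_nonneg (q := q * pA i t) ((totalDegree_mul_le_of_le hpd
    (totalDegree_pow_le_of_le (totalDegree_mul_le_of_le hq (totalDegree_X_le _)) 2)).trans
      (by norm_num))
  convert h using 2
  ring

theorem ineq_alpha (hE : E.Satisfies (medianSystem Z r C' c γ)) (i : Fin k) :
    E.SatisfiesIneq (pAlpha i) :=
  hE.2 _ (Or.inl (Or.inl (Or.inl ⟨i, rfl⟩)))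

theorem ineq_beta (hE : E.Satisfies (medianSystem Z r C' c γ)) (i : Fin k) :
    E.SatisfiesIneq (pBeta i) :=
  hE.2 _ (Or.inl (Or.inl (Or.inr ⟨i, rfl⟩)))

theorem level_le_extend (hE : E.Satisfies (medianSystem Z r C' c γ)) (i : Fin k)
    (t : Fin (numLevels C' c)) (hq : q.totalDegree ≤ 3) :
    2 ^ (t : ℕ) * c * E.extend (q ^ 2 * pA i t.succ)
      ≤ E.extend (q ^ 2 * pAlpha i * pA i t.succ) := by
  have h := (hE.2 _ (Or.inl (Or.inr ⟨i, t, rfl⟩))).extend_mul_sq_nonneg (q := q)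
    (totalDegree_mul_le_of_le (m := 2) (totalDegree_sub_le_of_le
      (totalDegree_mul_le_of_le (totalDegree_X_le _) (totalDegree_X_le _))
      (totalDegree_mul_le_of_le (totalDegree_X_le _) (totalDegree_C_le _ 1)))
      (totalDegree_pow_le_of_le hq 2))
  have e : (pA i t.succ * pAlpha i - pA i t.succ * C (2 ^ (t : ℕ) * c)) * q ^ 2 =
      q ^ 2 * pAlpha i * pA i t.succ - C (2 ^ (t : ℕ) * c) * (q ^ 2 * pA i t.succ) := by ring
  rw [e, map_sub, E.extend_C_mul] at h
  linarith

theorem extend_le_level (hE : E.Satisfies (medianSystem Z r C' c γ)) (i : Fin k)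
    (t : Fin (numLevels C' c)) (hq : q.totalDegree ≤ 3) :
    E.extend (q ^ 2 * pAlpha i * pA i t.succ)
      ≤ 2 ^ ((t : ℕ) + 1) * c * E.extend (q ^ 2 * pA i t.succ) := by
  have h := (hE.2 _ (Or.inr ⟨i, t, rfl⟩)).extend_mul_sq_nonneg (q := q)
    (totalDegree_mul_le_of_le (m := 2) (totalDegree_sub_le_of_le
      (totalDegree_mul_le_of_le (totalDegree_X_le _) (totalDegree_C_le _ 1))
      (totalDegree_mul_le_of_le (totalDegree_X_le _) (totalDegree_X_le _)))
      (totalDegree_pow_le_of_le hq 2))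
  have e : (pA i t.succ * C (2 ^ ((t : ℕ) + 1) * c) - pA i t.succ * pAlpha i) * q ^ 2 =
      C (2 ^ ((t : ℕ) + 1) * c) * (q ^ 2 * pA i t.succ) - q ^ 2 * pAlpha i * pA i t.succ := by
    ring
  rw [e, map_sub, E.extend_C_mul] at h
  linarith

/-- The product α(M - α) of two constraints is not directly available as nonnegative. The identity M
α(M - α) = α(M - α)² + α²(M - α) writes it through single constraints times squares. -/
theorem extend_alpha_sq_le_level (hE : E.Satisfies (medianSystem Z r C' c γ)) (hc : 0 < c)
    (i : Fin k) (t : Fin (numLevels C' c)) (hq : q.totalDegree ≤ 1) :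
    E.extend (q ^ 2 * pAlpha i ^ 2 * pA i t.succ)
      ≤ (2 ^ ((t : ℕ) + 1) * c) ^ 2 * E.extend (q ^ 2 * pA i t.succ) := by
  set M : ℝ := 2 ^ ((t : ℕ) + 1) * c with hM
  have hM0 : 0 < M := by positivity
  have h1 := hE.extend_le_level i t (q := q) (hq.trans (by norm_num))
  have h2 := hE.extend_le_level i t (q := q * pAlpha i)
    ((totalDegree_mul_le_of_le hq (totalDegree_X_le _)).trans (by norm_num))
  have h3 := hE.extend_sq_mul_ineq_level_nonneg i t.succ (hE.ineq_alpha i) (totalDegree_X_le _)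
    (q := q * (C M - pAlpha i)) (totalDegree_mul_le_of_le hq
      (totalDegree_sub_le_of_le (totalDegree_C_le _ 1) (totalDegree_X_le _)))
  rw [← hM] at h1 h2
  have e2 : (q * pAlpha i) ^ 2 * pA i t.succ = q ^ 2 * pAlpha i ^ 2 * pA i t.succ := by ring
  have e3 : (q * (C M - pAlpha i)) ^ 2 * pAlpha i * pA i t.succ =
      C (M ^ 2) * (q ^ 2 * pAlpha i * pA i t.succ)
        - C (2 * M) * (q ^ 2 * pAlpha i ^ 2 * pA i t.succ)
        + (q * pAlpha i) ^ 2 * pAlpha i * pA i t.succ := by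
    simp only [C_mul, C_pow, map_ofNat]; ring
  rw [e2] at h2
  rw [e3, map_add, map_sub, E.extend_C_mul, E.extend_C_mul] at h3
  have h4 : M * E.extend (q ^ 2 * pAlpha i ^ 2 * pA i t.succ) ≤
      M * (M * E.extend (q ^ 2 * pAlpha i * pA i t.succ)) := by linarith
  exact (le_of_mul_le_mul_left h4 hM0).trans
    ((mul_le_mul_of_nonneg_left h1 hM0.le).trans_eq (by ring))

theorem extend_beta_levelPoly_nonneg (hE : E.Satisfies (medianSystem Z r C' c γ)) (hc : 0 < c)
    {s : ℝ} (hs : 0 ≤ s) (i : Fin k) (hq : q.totalDegree ≤ 1) :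
    0 ≤ E.extend (q ^ 2 * (pBeta i * (1 - levelPoly c s i ^ 2))) := by
  have hd : (q ^ 2 * pBeta i).totalDegree ≤ 3 :=
    totalDegree_mul_le_of_le (totalDegree_pow_le_of_le hq 2) (totalDegree_X_le _)
  have e : q ^ 2 * (pBeta i * (1 - levelPoly c s i ^ 2)) =
      q ^ 2 * pBeta i - q ^ 2 * pBeta i * levelPoly c s i ^ 2 := by ring
  rw [e, map_sub, levelPoly, hE.extend_mul_levelSum_sq i _ (hd.trans (by norm_num)),
    ← hE.sum_extend_mul_level i (hd.trans (by norm_num)), sub_nonneg]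
  refine Finset.sum_le_sum fun t _ => mul_le_of_le_one_left ?_
    (pow_le_one₀ (levelWeight_nonneg hc hs t) (levelWeight_le_one hc t))
  exact hE.extend_sq_mul_ineq_level_nonneg i t (hE.ineq_beta i) (totalDegree_X_le _)
    (hq.trans (by norm_num))

/-- On level t ≥ 1 one has α_i ≤ 2^t c ≤ max (2^t c, s), so the weight α_i / max (2^t c, s) is at
most 1. -/
theorem extend_levelInvPoly_sq_le (hE : E.Satisfies (medianSystem Z r C' c γ)) (hc : 0 < c)
    (s : ℝ) (i : Fin k) (hq : q.totalDegree ≤ 1) :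
    E.extend (q ^ 2 * levelInvPoly c s i ^ 2) ≤ E.extend (q ^ 2) := by
  have hd := totalDegree_pow_le_of_le hq 2
  rw [levelInvPoly, mul_pow, ← mul_assoc, hE.extend_mul_levelSum_sq i _
    ((totalDegree_mul_le_of_le hd (totalDegree_pow_le_of_le (totalDegree_X_le _) 2)).trans
      (by norm_num)), ← hE.sum_extend_mul_level i (hd.trans (by norm_num))]
  refine Finset.sum_le_sum fun t _ => ?_
  induction t using Fin.cases with
  | zero =>
    simpa [levelInvWeight] using hE.extend_sq_mul_level_nonneg i 0 (hq.trans (by norm_num))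
  | succ t =>
    simp only [levelInvWeight, Fin.cases_succ]
    set M : ℝ := 2 ^ ((t : ℕ) + 1) * c with hM
    have hM0 : 0 < M := by positivity
    have h := hE.extend_alpha_sq_le_level hc i t hq
    have hn := hE.extend_sq_mul_level_nonneg i t.succ (hq.trans (by norm_num : 1 ≤ 3))
    rw [← hM] at h
    have hle : (1 / max M s) ^ 2 ≤ 1 / M ^ 2 := by
      rw [div_pow, one_pow]
      exact one_div_le_one_div_of_le (by positivity) (pow_le_pow_left₀ hM0.le (le_max_left _ _) 2)
    calc (1 / max M s) ^ 2 * E.extend (q ^ 2 * pAlpha i ^ 2 * pA i t.succ)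
        ≤ (1 / max M s) ^ 2 * (M ^ 2 * E.extend (q ^ 2 * pA i t.succ)) :=
          mul_le_mul_of_nonneg_left h (sq_nonneg _)
      _ ≤ 1 / M ^ 2 * (M ^ 2 * E.extend (q ^ 2 * pA i t.succ)) :=
          mul_le_mul_of_nonneg_right hle (by positivity)
      _ = E.extend (q ^ 2 * pA i t.succ) := by field_simp

/-- On level t ≥ 1, with M = 2^t c, the bound α_i ≥ M/2 makes the two weights add up to at least (s
+ M/2) / max (M, s) ≥ 1/2. On level 0 the first weight is already 1. -/
theorem half_le_extend_levelPoly_add (hE : E.Satisfies (medianSystem Z r C' c γ)) (hc : 0 < c)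
    {s : ℝ} (hs : 0 ≤ s) (i : Fin k) (hq : q.totalDegree ≤ 1) :
    1 / 2 * E.extend (q ^ 2) ≤
      E.extend (q ^ 2 * levelPoly c s i) + E.extend (q ^ 2 * levelInvPoly c s i) := by
  have hd := totalDegree_pow_le_of_le hq 2
  rw [levelPoly, levelInvPoly, ← mul_assoc, E.extend_mul_levelSum, E.extend_mul_levelSum,
    ← hE.sum_extend_mul_level i (hd.trans (by norm_num)), Finset.mul_sum,
    ← Finset.sum_add_distrib]
  refine Finset.sum_le_sum fun t _ => ?_
  have hn := hE.extend_sq_mul_level_nonneg i t (hq.trans (by norm_num : 1 ≤ 3))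
  induction t using Fin.cases with
  | zero =>
    simp only [levelWeight, levelInvWeight, Fin.cases_zero]
    linarith
  | succ t =>
    have h := mul_le_mul_of_nonneg_left
      (hE.level_le_extend i t (hq.trans (by norm_num : 1 ≤ 3)))
      (levelInvWeight_nonneg (s := s) hc t.succ)
    refine le_trans ?_ (add_le_add_right h _)
    rw [← mul_assoc, ← add_mul]
    refine mul_le_mul_of_nonneg_right ?_ hn
    simp only [levelWeight, levelInvWeight, Fin.cases_succ, pow_succ]
    have hM0 : 0 < 2 ^ (t : ℕ) * c := by positivity
    rw [one_div_mul_eq_div, ← add_div,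
      le_div_iff₀ (lt_of_lt_of_le (by positivity) (le_max_left _ _))]
    rcases max_choice (2 ^ (t : ℕ) * 2 * c) s with h | h <;> rw [h] <;> linarith

theorem extend_alpha_mul_levelPoly_le (hE : E.Satisfies (medianSystem Z r C' c γ)) (hc : 0 < c)
    (s : ℝ) (i : Fin k) :
    E.extend (pAlpha i * levelPoly c s i) ≤ E.extend (pAlpha i) := by
  rw [levelPoly, E.extend_mul_levelSum,
    ← hE.sum_extend_mul_level i ((totalDegree_X_le _).trans (by norm_num))]
  refine Finset.sum_le_sum fun t _ => mul_le_of_le_one_left ?_ (levelWeight_le_one hc t)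
  simpa using hE.extend_sq_mul_ineq_level_nonneg i t (hE.ineq_alpha i) (totalDegree_X_le _)
    (q := 1) (totalDegree_one_le _)

/-- Both weights have the same denominator max (2^t c, s), and level 0 contributes nothing because
a_{i,0} α_i = 0. With s = α'_i this is the balance that later cancels the Z_i. -/
theorem extend_alpha_mul_levelPoly_eq (hE : E.Satisfies (medianSystem Z r C' c γ)) (s : ℝ)
    (i : Fin k) (hp : p.totalDegree ≤ 6) :
    E.extend (p * (pAlpha i * levelPoly c s i)) = s * E.extend (p * levelInvPoly c s i) := by
  rw [levelPoly, levelInvPoly, ← mul_assoc, ← mul_assoc, E.extend_mul_levelSum,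
    E.extend_mul_levelSum, Finset.mul_sum]
  refine Finset.sum_congr rfl fun t _ => ?_
  induction t using Fin.cases with
  | zero => rw [hE.extend_mul_alpha_level_zero i hp]; simp
  | succ t =>
    simp only [levelWeight, levelInvWeight, Fin.cases_succ]
    ring

end Satisfies

end PseudoExpectation

end Levels

/-! ### The bound on the pseudo-expected distance -/

theorem CentralityDual.gamma_le {k d : ℕ} {Z : Fin k → EuclideanSpace ℝ (Fin d)}
    {x : EuclideanSpace ℝ (Fin d)} {r : ℝ} {α β : Fin k → ℝ} {γ : ℝ}
    (h : CentralityDual Z x r α β γ) : γ ≤ (k : ℝ) / 10 := by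
  let w : BlockIdx k d → ℝ := Sum.elim (fun _ => 1) fun _ => 0
  have hw := h.lagrangian_le _ (Matrix.posSemidef_vecMulVec_self_star w)
  simp [Matrix.vecMulVec, w] at hw
  have := Finset.sum_nonneg fun i (_ : i ∈ Finset.univ) => h.beta_nonneg i
  linarith

section Moments

variable {V : Type} (E : PseudoExpectation V 8)

theorem PseudoExpectation.posSemidef_moments {ι : Type*} [Fintype ι] {q : MvPolynomial V ℝ}
    {w : ι → MvPolynomial V ℝ} (h : ∀ i, (q * w i).totalDegree ≤ 4) :
    (Matrix.of fun i j => E.extend (q ^ 2 * (w i * w j))).PosSemidef := by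
  refine .of_dotProduct_mulVec_nonneg ?_ fun z => ?_
  · ext i j
    simp [mul_comm]
  · have hs := E.extend_sq_nonneg (q := ∑ i, C (z i) * (q * w i))
      (Nat.mul_le_mul_left 2 (totalDegree_finsetSum_le fun i _ =>
        totalDegree_C_mul_le_of_le _ (h i)))
    have e : (∑ i, C (z i) * (q * w i)) ^ 2 =
        ∑ i, ∑ j, C (z i) * (C (z j) * (q ^ 2 * (w i * w j))) := by
      rw [pow_two, Finset.sum_mul_sum]
      exact Finset.sum_congr rfl fun i _ => Finset.sum_congr rfl fun j _ => by ring
    rw [e] at hs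
    simp only [map_sum, E.extend_C_mul] at hs
    simpa [dotProduct, Matrix.mulVec, Finset.mul_sum, mul_comm, mul_left_comm] using hs

/-- Numerical multipliers can be paired with the pseudo-moment matrix of (1, b, v) weighted by q².
Only q·b_i and q·v_j need degree at most 4, which leaves room for the quadratic `levelInvPoly`. -/
theorem CentralityDual.extend_le {k d : ℕ} {Z : Fin k → EuclideanSpace ℝ (Fin d)}
    {x : EuclideanSpace ℝ (Fin d)} {r : ℝ} {α β : Fin k → ℝ} {γ : ℝ}
    (h : CentralityDual Z x r α β γ) {b : Fin k → MvPolynomial V ℝ} {v : Fin d → MvPolynomial V ℝ}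
    (hb : ∀ i, (b i).totalDegree ≤ 2) (hv : ∀ j, (v j).totalDegree ≤ 2)
    {q : MvPolynomial V ℝ} (hq : q.totalDegree ≤ 1) :
    ∑ i, α i * (∑ j, (Z i j - x j) * E.extend (q ^ 2 * (b i * v j)) - r * E.extend (q ^ 2 * b i))
        + ∑ i, β i * (E.extend (q ^ 2) - E.extend (q ^ 2 * b i ^ 2))
        + γ * (E.extend (q ^ 2) - ∑ j, E.extend (q ^ 2 * v j ^ 2))
      ≤ (k : ℝ) / 10 * E.extend (q ^ 2) - ∑ i, E.extend (q ^ 2 * b i) := by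
  have hY := h.lagrangian_le _ (E.posSemidef_moments (q := q)
    (w := (Sum.elim (fun _ => 1) (Sum.elim b v) : BlockIdx k d → MvPolynomial V ℝ)) (by
      rintro (_ | i | j)
      exacts [(totalDegree_mul_le_of_le hq (totalDegree_one_le 2)).trans (by norm_num),
        (totalDegree_mul_le_of_le hq (hb i)).trans (by norm_num),
        (totalDegree_mul_le_of_le hq (hv j)).trans (by norm_num)]))
  simpa [← pow_two] using hY

end Moments

namespace PseudoExpectation

variable {k d : ℕ} {Z : Fin k → EuclideanSpace ℝ (Fin d)} {μ : EuclideanSpace ℝ (Fin d)}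
  {r C' c γ : ℝ} {E : PseudoExpectation (MedianVar k d (numLevels C' c)) 8}

/-! ### Bounds on the multipliers of the system. -/

namespace Satisfies

theorem extend_beta_nonneg (hE : E.Satisfies (medianSystem Z r C' c γ)) (i : Fin k) :
    0 ≤ E.extend (pBeta i) := by
  simpa using (hE.ineq_beta i).extend_mul_sq_nonneg (q := 1)
    ((totalDegree_mul_le_of_le (m := 1) (n := 7) (totalDegree_X_le _)
      (by simp)))

theorem gamma_mul_le (hE : E.Satisfies (medianSystem Z r C' c γ)) (t : ℝ) :
    γ * (1 - d * t ^ 2) ≤ (k : ℝ) / 10 := by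
  have h := hE.certificate_le (b := fun _ => 0) (v := fun _ => C t) (q := 1)
    (fun _ => totalDegree_zero_le _) (fun _ => totalDegree_C_le _ _) (totalDegree_one_le _)
  have e : (1 : MvPolynomial (MedianVar k d (numLevels C' c)) ℝ) ^ 2 *
      (1 - ∑ _j : Fin d, C t ^ 2) = C (1 - d * t ^ 2) * 1 := by
    simp
  rw [e, E.extend_C_mul, E.extend_one] at h
  simp [E.extend_one] at h
  have := Finset.sum_nonneg fun i (_ : i ∈ Finset.univ) => hE.extend_beta_nonneg i
  linarith

theorem gamma_le (hE : E.Satisfies (medianSystem Z r C' c γ)) : γ ≤ (k : ℝ) / 10 := by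
  simpa using hE.gamma_mul_le 0

/-- A negative γ is refuted by a long constant vector v, which exists only when d > 0. -/
theorem gamma_nonneg (hE : E.Satisfies (medianSystem Z r C' c γ)) (hd : 0 < d) : 0 ≤ γ := by
  by_contra! hneg
  have hu : 0 ≤ 1 + ((k : ℝ) / 10 + 1) / (-γ) := by
    have : 0 < -γ := by linarith
    positivity
  -- The value of t² is chosen so that γ(1 - t²) = k/10 + 1, and d ≥ 1 can only increase the left
  -- side.
  have h := hE.gamma_mul_le (√(1 + ((k : ℝ) / 10 + 1) / (-γ)))
  rw [Real.sq_sqrt hu] at h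
  have hd1 : (1 : ℝ) ≤ d := by exact_mod_cast hd
  have h2 : γ * (1 - (1 + ((k : ℝ) / 10 + 1) / (-γ))) = (k : ℝ) / 10 + 1 := by
    have := hneg.ne
    field_simp
    ring
  have h3 : γ * (1 - (1 + ((k : ℝ) / 10 + 1) / (-γ)))
      ≤ γ * (1 - d * (1 + ((k : ℝ) / 10 + 1) / (-γ))) :=
    mul_le_mul_of_nonpos_left (sub_le_sub_left (le_mul_of_one_le_left hu hd1) 1) hneg.le
  linarith

/-- Testing at b = -1, v = 0 removes the β terms and turns each α term into r α_i, against k/10 + k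
on the right. -/
theorem sum_extend_alpha_le (hE : E.Satisfies (medianSystem Z r C' c γ)) (hd : 0 < d) :
    r * ∑ i, E.extend (pAlpha i) ≤ 11 / 10 * (k : ℝ) := by
  have h := hE.certificate_le (b := fun _ => C (-1)) (v := fun _ => 0) (q := 1)
    (fun _ => totalDegree_C_le _ _) (fun _ => totalDegree_zero_le _) (totalDegree_one_le _)
  have e : ∀ i : Fin k, (1 : MvPolynomial (MedianVar k d (numLevels C' c)) ℝ) ^ 2 *
      (pAlpha i * C (-1) * (∑ j, (C (Z i j) - pX j) * 0 - C r)) = C r * pAlpha i := fun i => by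
    simp [mul_comm]
  simp only [e, E.extend_C_mul] at h
  simp [E.extend_one, ← Finset.mul_sum] at h
  linarith [hE.gamma_nonneg hd]

/-! ### Combining the certificates at x and at μ. -/

variable {α' β' : Fin k → ℝ} {γ' : ℝ}

/-- This adds both certificates in direction zero: the β and γ terms are nonnegative, and 3/10 = 1/2
- 2 · 1/10. The factor q² is kept so that q = x_j - μ_j can be inserted and summed over j. -/
theorem extend_sq_le_extend_alpha (hE : E.Satisfies (medianSystem Z r C' c γ)) (hc : 0 < c)
    (hd : 0 < d) (hμ : CentralityDual Z μ r α' β' γ')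
    {q : MvPolynomial (MedianVar k d (numLevels C' c)) ℝ} (hq : q.totalDegree ≤ 1) :
    3 / 10 * (k : ℝ) * E.extend (q ^ 2) ≤
      2 * r * ∑ i, E.extend (q ^ 2 * (pAlpha i * levelPoly c (α' i) i)) := by
  have h1 := hE.certificate_le (b := fun i => levelPoly c (α' i) i) (v := fun _ => 0)
    (fun i => totalDegree_levelSum_le _ i) (fun _ => totalDegree_zero_le _) hq
  have h2 := hμ.extend_le E (b := fun i => levelInvPoly c (α' i) i) (v := fun _ => 0)
    (fun i => totalDegree_levelInvPoly_le _ i) (fun _ => totalDegree_zero_le _) hq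
  have e : ∀ i : Fin k, q ^ 2 * (pAlpha i * levelPoly c (α' i) i *
      (∑ j, (C (Z i j) - pX j) * 0 - C r)) =
      C (-r) * (q ^ 2 * (pAlpha i * levelPoly c (α' i) i)) := fun i => by
    simp; ring
  simp only [e, E.extend_C_mul, ← Finset.mul_sum] at h1
  have e2 : ∀ i, α' i * (∑ j, (Z i j - μ j) * E.extend (q ^ 2 * (levelInvPoly c (α' i) i * 0))
      - r * E.extend (q ^ 2 * levelInvPoly c (α' i) i)) =
      -r * E.extend (q ^ 2 * (pAlpha i * levelPoly c (α' i) i)) := fun i => by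
    rw [hE.extend_alpha_mul_levelPoly_eq _ i
      ((totalDegree_pow_le_of_le hq 2).trans (by norm_num))]
    simp; ring
  simp only [e2, ← Finset.mul_sum] at h2
  have h3 := Finset.sum_nonneg fun i (_ : i ∈ Finset.univ) =>
    hE.extend_beta_levelPoly_nonneg hc (hμ.alpha_nonneg i) i hq
  have h4 := Finset.sum_nonneg fun i (_ : i ∈ Finset.univ) =>
    mul_nonneg (hμ.beta_nonneg i) (sub_nonneg.2 (hE.extend_levelInvPoly_sq_le hc (α' i) i hq))
  have h5 := Finset.sum_le_sum fun i (_ : i ∈ Finset.univ) =>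
    hE.half_le_extend_levelPoly_add hc (hμ.alpha_nonneg i) i hq
  simp only [Finset.sum_const, Finset.card_univ, Fintype.card_fin, nsmul_eq_mul,
    Finset.sum_add_distrib] at h5
  have h6 : 0 ≤ E.extend (q ^ 2) := E.extend_sq_nonneg (by omega)
  have h7 := mul_nonneg (hE.gamma_nonneg hd) h6
  have h8 := mul_nonneg hμ.gamma_nonneg h6
  simp at h1 h2
  linarith

theorem extend_dist_le_extend_alpha (hE : E.Satisfies (medianSystem Z r C' c γ)) (hc : 0 < c)
    (hd : 0 < d) (hμ : CentralityDual Z μ r α' β' γ') :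
    3 / 10 * (k : ℝ) * E.extend (sqDistPoly μ) ≤
      2 * r * ∑ i, E.extend (sqDistPoly μ * (pAlpha i * levelPoly c (α' i) i)) := by
  simp only [sqDistPoly, Finset.sum_mul, map_sum]
  rw [Finset.sum_comm, Finset.mul_sum, Finset.mul_sum]
  exact Finset.sum_le_sum fun j _ => hE.extend_sq_le_extend_alpha hc hd hμ
    (totalDegree_sub_le_of_le (totalDegree_X_le _) (totalDegree_C_le _ _))

/-- The certificate identities at `x` and at `μ`, tested in the opposite directions
`s (μ - x)` and `s (x - μ)`. -/
theorem extend_alpha_dist_le (hE : E.Satisfies (medianSystem Z r C' c γ)) (hc : 0 < c)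
    (hμ : CentralityDual Z μ r α' β' γ') (s : ℝ) :
    s * ∑ i, E.extend (sqDistPoly μ * (pAlpha i * levelPoly c (α' i) i))
        - 2 * r * ∑ i, E.extend (pAlpha i * levelPoly c (α' i) i)
        + (γ + γ') * (1 - s ^ 2 * E.extend (sqDistPoly μ)) ≤ -(3 / 10 * (k : ℝ)) := by
  have hX : ∀ j, (pX j - C (μ j) :
      MvPolynomial (MedianVar k d (numLevels C' c)) ℝ).totalDegree ≤ 1 := fun j =>
    totalDegree_sub_le_of_le (totalDegree_X_le _) (totalDegree_C_le _ _)
  have h1 := hE.certificate_le (b := fun i => levelPoly c (α' i) i)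
    (v := fun j => C (-s) * (pX j - C (μ j))) (fun i => totalDegree_levelSum_le _ i)
    (fun j => totalDegree_C_mul_le_of_le _ (hX j)) (totalDegree_one_le 1)
  have h2 := hμ.extend_le E (b := fun i => levelInvPoly c (α' i) i)
    (v := fun j => C s * (pX j - C (μ j))) (fun i => totalDegree_levelInvPoly_le _ i)
    (fun j => totalDegree_C_mul_le_of_le _ ((hX j).trans one_le_two)) (totalDegree_one_le 1)
  have h3 := Finset.sum_nonneg fun i (_ : i ∈ Finset.univ) =>
    hE.extend_beta_levelPoly_nonneg hc (hμ.alpha_nonneg i) i (totalDegree_one_le 1)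
  have h4 := Finset.sum_nonneg fun i (_ : i ∈ Finset.univ) =>
    mul_nonneg (hμ.beta_nonneg i)
      (sub_nonneg.2 (hE.extend_levelInvPoly_sq_le hc (α' i) i (totalDegree_one_le 1)))
  have h5 := Finset.sum_le_sum fun i (_ : i ∈ Finset.univ) =>
    hE.half_le_extend_levelPoly_add hc (hμ.alpha_nonneg i) i (totalDegree_one_le 1)
  simp only [Finset.sum_const, Finset.card_univ, Fintype.card_fin, nsmul_eq_mul,
    Finset.sum_add_distrib] at h5
  have e1 : (∑ j, (C s * (pX j - C (μ j))) ^ 2 :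
      MvPolynomial (MedianVar k d (numLevels C' c)) ℝ) = C (s ^ 2) * sqDistPoly μ := by
    rw [sqDistPoly, Finset.mul_sum]
    exact Finset.sum_congr rfl fun j _ => by rw [C_pow]; ring
  have e1' : (∑ j, (C (-s) * (pX j - C (μ j))) ^ 2 :
      MvPolynomial (MedianVar k d (numLevels C' c)) ℝ) = C (s ^ 2) * sqDistPoly μ := by
    rw [← e1]
    exact Finset.sum_congr rfl fun j _ => by rw [C_neg]; ring
  have e2 : E.extend (1 ^ 2 * (1 - ∑ j, (C (-s) * (pX j - C (μ j))) ^ 2)) =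
      1 - s ^ 2 * E.extend (sqDistPoly μ) := by
    rw [e1', one_pow, one_mul, map_sub, E.extend_C_mul, E.extend_one]
  have e3 : ∑ j, E.extend (1 ^ 2 * (C s * (pX j - C (μ j))) ^ 2) =
      s ^ 2 * E.extend (sqDistPoly μ) := by
    rw [← E.extend_C_mul, ← e1, map_sum]
    simp only [one_pow, one_mul]
  -- By the balance both inner products carry the same weight, and -s⟨Z_i - x, x - μ⟩ + s⟨Z_i - μ, x
  -- - μ⟩ = s‖x - μ‖² no longer involves Z_i.
  have key : ∀ i, E.extend (1 ^ 2 * (pAlpha i * levelPoly c (α' i) i *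
        (∑ j, (C (Z i j) - pX j) * (C (-s) * (pX j - C (μ j))) - C r)))
      + α' i * (∑ j, (Z i j - μ j) *
          E.extend (1 ^ 2 * (levelInvPoly c (α' i) i * (C s * (pX j - C (μ j)))))
        - r * E.extend (1 ^ 2 * levelInvPoly c (α' i) i)) =
      s * E.extend (sqDistPoly μ * (pAlpha i * levelPoly c (α' i) i))
        - 2 * r * E.extend (pAlpha i * levelPoly c (α' i) i) := fun i => by
    have ha : ∀ j, α' i * E.extend (levelInvPoly c (α' i) i * (C s * (pX j - C (μ j)))) =
        E.extend (C s * (pX j - C (μ j)) * (pAlpha i * levelPoly c (α' i) i)) := fun j => by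
      rw [hE.extend_alpha_mul_levelPoly_eq (α' i) i
        ((totalDegree_C_mul_le_of_le _ (hX j)).trans (by norm_num)),
        mul_comm (levelInvPoly c (α' i) i)]
    have hb : α' i * E.extend (levelInvPoly c (α' i) i) =
        E.extend (pAlpha i * levelPoly c (α' i) i) := by
      simpa using (hE.extend_alpha_mul_levelPoly_eq (p := 1) (α' i) i
        (totalDegree_one_le 6)).symm
    simp only [one_pow, one_mul]
    rw [mul_sub (α' i), mul_left_comm _ r, hb, Finset.mul_sum]
    simp only [mul_left_comm (α' i), ha]
    simp only [← E.extend_C_mul]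
    rw [← map_sum, ← map_sub, ← map_add, ← map_sub]
    congr 1
    simp only [sqDistPoly, Finset.sum_mul, Finset.mul_sum, mul_sub, C_mul, C_sub, map_ofNat, C_neg]
    rw [sub_add_sub_comm, ← Finset.sum_add_distrib]
    congr 1
    · exact Finset.sum_congr rfl fun j _ => by ring
    · ring
  have hkey := Finset.sum_congr rfl fun i (_ : i ∈ Finset.univ) => key i
  rw [Finset.sum_add_distrib, Finset.sum_sub_distrib, ← Finset.mul_sum, ← Finset.mul_sum] at hkey
  rw [e2] at h1
  rw [e3] at h2
  simp only [one_pow, one_mul, E.extend_one] at *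
  linarith

theorem sqDist_le (hE : E.Satisfies (medianSystem Z r C' c γ)) (hk : 0 < k) (hr : 0 < r)
    (hc : 0 < c) (hμ : CertifiablyCentral Z r (1 / 10) μ) : E.sqDist μ ≤ 76 * r ^ 2 := by
  have hE' : E.sqDist μ = E.extend (sqDistPoly μ) := (E.extend_eq _).symm
  rw [hE']
  set ρ := E.extend (sqDistPoly μ) with hρ
  rcases Nat.eq_zero_or_pos d with rfl | hd
  · have : ρ = 0 := by rw [hρ, sqDistPoly]; simp
    rw [this]
    positivity
  obtain ⟨α', β', γ', hdual⟩ := hμ.exists_dual hk hr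
  by_contra! hlt
  have h1 := hE.extend_dist_le_extend_alpha hc hd hdual
  -- The coefficient of kρ gained is 3s/(20r) from `h1`, against a loss of s²/5 from γ + γ' ≤ k/5.
  -- Any 0 < s < 3/(4r) leaves a net gain.
  have h2 := hE.extend_alpha_dist_le hc hdual (1 / (2 * r))
  have h3 := hE.sum_extend_alpha_le hd
  have h4 := Finset.sum_le_sum fun i (_ : i ∈ Finset.univ) =>
    hE.extend_alpha_mul_levelPoly_le hc (α' i) i
  rw [← hρ] at h1 h2
  set G := ∑ i, E.extend (pAlpha i * levelPoly c (α' i) i)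
  set GD := ∑ i, E.extend (sqDistPoly μ * (pAlpha i * levelPoly c (α' i) i))
  have h5 := mul_le_mul_of_nonneg_left h4 hr.le
  have hk' : (0 : ℝ) < k := Nat.cast_pos.2 hk
  obtain ⟨τ, hτ⟩ : ∃ τ, ρ = τ * r ^ 2 := ⟨ρ / r ^ 2, by field_simp⟩
  have hτ76 : 76 < τ := by
    rw [hτ] at hlt
    exact lt_of_mul_lt_mul_right hlt (by positivity)
  have e1 : (1 / (2 * r)) ^ 2 * ρ = τ / 4 := by rw [hτ]; field_simp; ring
  have h6 : 3 / 40 * k * τ ≤ 1 / (2 * r) * GD := by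
    rw [hτ] at h1
    rw [one_div_mul_eq_div, le_div_iff₀ (by positivity)]
    have : r * (3 / 20 * k * τ * r) ≤ r * GD := by linarith
    have := le_of_mul_le_mul_left this hr
    linarith
  have h7 : k / 5 * (1 - τ / 4) ≤ (γ + γ') * (1 - τ / 4) :=
    mul_le_mul_of_nonpos_right (by linarith [hE.gamma_le, hdual.gamma_le]) (by linarith)
  rw [e1] at h2
  -- Altogether (3/40 - 1/20) τ ≤ 11/5 - 1/5 - 3/10, that is τ ≤ 68, so 76 leaves slack.
  nlinarith [mul_lt_mul_of_pos_left hτ76 hk']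

end Satisfies

end PseudoExpectation

theorem mainTheorem5 :
    ∃ K : ℝ, ∀ (d k : ℕ), 0 < k →
      ∀ (Z : Fin k → EuclideanSpace ℝ (Fin d)) (μ : EuclideanSpace ℝ (Fin d)) (r : ℝ), 0 < r →
        CertifiablyCentral Z r (1 / 10) μ →
        ∀ (c C γ : ℝ), 0 < c → 0 < C →
          ∀ E : PseudoExpectation (MedianVar k d (numLevels C c)) 8,
            E.Satisfies (medianSystem Z r C c γ) →
              E.sqDist μ ≤ K * r ^ 2 :=
  ⟨76, fun _ _ hk _ _ _ hr hμ _ _ _ hc _ _ hE => hE.sqDist_le hk hr hc hμ⟩
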